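/- Fix a confidence level $\alpha\in(0,1)$, a horizon $T\ge 1$ and constants $L,B$. There is a constant $C_\alpha>0$, depending only on $\alpha,T,L,B$, such that the following holds for all $d,m\ge 0$. Consider a controlled Markov chain with states $x_t\in\mathbb{R}^d$, actions $u_t\in\mathbb{R}^m$, initial law $p_0$ and transition kernel $P(\cdot\mid x,u)$ (for instance $x_{t+1}=f(x_t)+g(x_t)u_t+w_t$ with a random disturbance $w_t$ whose law depends only on $(x_t,u_t)$). A (stochastic, stationary) policy $\pi$ is a Markov kernel $\pi(\cdot\mid x)$ on actions; under $\pi$, $x_0\sim p_0$, $u_t\sim\pi(\cdot\mid x_t)$, $x_{t+1}\sim P(\cdot\mid x_t,u_t)$. For a measurable one-step loss $\ell(x,u)$ let $$L_T=\sum_{t=0}^{T-1}\ell(x_t,u_t),\qquad J_\alpha(\pi)=\mathrm{CVaR}_\alpha(L_T)=\min_{s\in\mathbb{R}}\Big\{s+\tfrac1\alpha\,\mathbb{E}_\pi\big[(L_T-s)_+\big]\Big\},\qquad d_\pi=\frac1T\sum_{t=0}^{T-1}\mathbb{P}_\pi(x_t\in\cdot).$$ Let $\pi,\pi'$ be policies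 and $\beta\ge 0$ with $\mathrm{KL}(\pi'(\cdot\mid x)\,\|\,\pi(\cdot\mid x))\le\beta$ for every $x$, and suppose that the pairs $(x_t,u_t)$, $t<T$, under $\pi$ almost surely lie in a set $K\subseteq\mathbb{R}^d\times\mathbb{R}^m$ on which $|\ell|\le B$ and $|\ell(x,u)-\ell(x',u')|\le L(\|x-x'\|+\|u-u'\|)$. Then the minimum defining $J_\alpha(\pi)$ is attained. Let $s^\star$ be any minimizer, let $\omega(x,u)=\frac{d\pi'(\cdot\mid x)}{d\pi(\cdot\mid x)}(u)$ be the importance ratio, and let the CVaR-weighted advantage be $$\tilde A^{(\alpha)}_\pi(x,u)=g(x,u)-\int g(x,v)\,\pi(dv\mid x),\qquad g(x,u)=\frac{T}{\alpha}\,\mathbb{E}_\pi\big[(L_T-s^\star)_+\,\big|\,x_\tau=x,\ u_\tau=u\big],$$ where $\tau$ is uniform on $\{0,\dots,T-1\}$ and independent of the trajectory. Then $\omega\,\tilde A^{(\alpha)}_\pi$ is integrable with respect to $d_\pi(dx)\,\pi(du\mid x)$, and $$J_\alpha(\pi')\;\le\;J_\alpha(\pi)+\mathbb{E}_{x\sim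 d_\pi,\,u\sim\pi(\cdot\mid x)}\big[\omega(x,u)\,\tilde A^{(\alpha)}_\pi(x,u)\big]+C_\alpha\sqrt{\beta}.$$ In particular, the inequality holds with any additional nonnegative remainder, such as an $o(\|\pi'-\pi\|)$ term, which here can be taken to be zero. -/

import Mathlib

open MeasureTheory ProbabilityTheory
open scoped ENNReal

namespace CVaRTrustRegion

/-- Joint law of the first `n` state-action pairs `(x_0, u_0), …, (x_{n-1}, u_{n-1})` and of the
next state `x_n`, for the initial law `p₀`, the transition kernel `P` and the policy `π`:
`x_0 ∼ p₀`, `u_t ∼ π(· | x_t)`, `x_{t+1} ∼ P(· | x_t, u_t)`. -/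
noncomputable def trajLaw {X U : Type*} [MeasurableSpace X] [MeasurableSpace U]
    (p₀ : Measure X) (P : Kernel (X × U) X) (π : Kernel X U) :
    (n : ℕ) → Measure ((Fin n → X × U) × X)
  | 0 => p₀.map (fun x => (Fin.elim0, x))
  | n + 1 =>
    (((trajLaw p₀ P π n) ⊗ₘ (π.comap Prod.snd measurable_snd)) ⊗ₘ
        (P.comap (fun z : ((Fin n → X × U) × X) × U => (z.1.2, z.2))
          ((measurable_snd.comp measurable_fst).prodMk measurable_snd))).map
      (fun z => (Fin.snoc (α := fun _ => X × U) z.1.1.1 (z.1.1.2, z.1.2), z.2))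

theorem measurable_snocStep {X U : Type*} [MeasurableSpace X] [MeasurableSpace U] (n : ℕ) :
    Measurable (fun z : (((Fin n → X × U) × X) × U) × X =>
      ((Fin.snoc (α := fun _ => X × U) z.1.1.1 (z.1.1.2, z.1.2) : Fin (n + 1) → X × U),
        z.2)) := by
  refine Measurable.prodMk (measurable_pi_iff.2 fun i => ?_) measurable_snd
  refine Fin.lastCases ?_ (fun j => ?_) i
  · simp only [Fin.snoc_last]
    fun_prop
  · simp only [Fin.snoc_castSucc]
    fun_prop

instance isProbabilityMeasure_trajLaw {X U : Type*} [MeasurableSpace X] [MeasurableSpace U]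
    (p₀ : Measure X) [IsProbabilityMeasure p₀] (P : Kernel (X × U) X) [IsMarkovKernel P]
    (π : Kernel X U) [IsMarkovKernel π] (n : ℕ) :
    IsProbabilityMeasure (trajLaw p₀ P π n) := by
  induction n with
  | zero =>
    exact Measure.isProbabilityMeasure_map (by fun_prop)
  | succ n ih =>
    exact Measure.isProbabilityMeasure_map (measurable_snocStep n).aemeasurable

/-- The total loss `L_T = ∑_{t < T} ℓ(x_t, u_t)` of a trajectory. -/
noncomputable def totalLoss {X U : Type*} (ℓ : X → U → ℝ) {T : ℕ}
    (τ : (Fin T → X × U) × X) : ℝ :=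
  ∑ t : Fin T, ℓ (τ.1 t).1 (τ.1 t).2

/-- The Rockafellar–Uryasev objective `s + α⁻¹ 𝔼[(Z - s)₊]`. -/
noncomputable def ruObjective {Ω : Type*} [MeasurableSpace Ω] (α : ℝ) (μ : Measure Ω)
    (Z : Ω → ℝ) (s : ℝ) : ℝ :=
  s + α⁻¹ * ∫ ω, max (Z ω - s) 0 ∂μ

/-- `CVaR_α(Z) = min_s { s + α⁻¹ 𝔼[(Z - s)₊] }`. -/
noncomputable def cvar {Ω : Type*} [MeasurableSpace Ω] (α : ℝ) (μ : Measure Ω)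
    (Z : Ω → ℝ) : ℝ :=
  ⨅ s : ℝ, ruObjective α μ Z s

/-- `J_α(π) = CVaR_α(L_T(π))`. -/
noncomputable def riskObjective {X U : Type*} [MeasurableSpace X] [MeasurableSpace U]
    (p₀ : Measure X) (P : Kernel (X × U) X) (ℓ : X → U → ℝ) (T : ℕ) (α : ℝ)
    (π : Kernel X U) : ℝ :=
  cvar α (trajLaw p₀ P π T) (totalLoss ℓ)

/-- The state occupancy `d_π = T⁻¹ ∑_{t < T} ℙ_π(x_t ∈ ·)`. -/
noncomputable def occupancy {X U : Type*} [MeasurableSpace X] [MeasurableSpace U]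
    (p₀ : Measure X) (P : Kernel (X × U) X) (T : ℕ) (π : Kernel X U) : Measure X :=
  (T : ℝ≥0∞)⁻¹ • ∑ t : Fin T, (trajLaw p₀ P π T).map (fun τ => (τ.1 t).1)

/-- Law of a pair (uniform random time in `{0, …, T-1}`, independent trajectory). Evaluated at the
random time, the state has law `occupancy p₀ P T π`, and the action is drawn from `π`. -/
noncomputable def randomTimeLaw {X U : Type*} [MeasurableSpace X] [MeasurableSpace U]
    (p₀ : Measure X) (P : Kernel (X × U) X) (T : ℕ) (π : Kernel X U) :
    Measure (Fin T × ((Fin T → X × U) × X)) :=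
  (uniformOn (Set.univ : Set (Fin T))).prod (trajLaw p₀ P π T)

instance isFiniteMeasure_randomTimeLaw {X U : Type*} [MeasurableSpace X] [MeasurableSpace U]
    (p₀ : Measure X) [IsProbabilityMeasure p₀] (P : Kernel (X × U) X) [IsMarkovKernel P]
    (T : ℕ) (π : Kernel X U) [IsMarkovKernel π] :
    IsFiniteMeasure (randomTimeLaw p₀ P T π) := by
  have : IsFiniteMeasure (uniformOn (Set.univ : Set (Fin T))) := by
    unfold uniformOn
    infer_instance
  unfold randomTimeLaw
  infer_instance

/-- The per-step contribution to the CVaR surrogate with threshold `s`: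
`g(x, u) = (T / α) 𝔼_π[(L_T - s)₊ | x_t = x, u_t = u]`, with `t` uniform on `{0, …, T-1}` and
independent of the trajectory. (The factor `T` offsets the `1 / T` in the occupancy measure.) -/
noncomputable def surrogateActionValue {X U : Type*} [MeasurableSpace X] [MeasurableSpace U]
    (p₀ : Measure X) [IsProbabilityMeasure p₀] (P : Kernel (X × U) X) [IsMarkovKernel P]
    (ℓ : X → U → ℝ) (T : ℕ) (α : ℝ) (π : Kernel X U) [IsMarkovKernel π] (s : ℝ)
    (x : X) (u : U) : ℝ :=
  (T / α) * ∫ y, max (y - s) 0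
    ∂(condDistrib (fun q : Fin T × ((Fin T → X × U) × X) => totalLoss ℓ q.2)
        (fun q => q.2.1 q.1) (randomTimeLaw p₀ P T π) (x, u))

/-- The CVaR-weighted advantage `Ã(x, u) = g(x, u) - 𝔼_{v ∼ π(·|x)}[g(x, v)]`. -/
noncomputable def cvarAdvantage {X U : Type*} [MeasurableSpace X] [MeasurableSpace U]
    (p₀ : Measure X) [IsProbabilityMeasure p₀] (P : Kernel (X × U) X) [IsMarkovKernel P]
    (ℓ : X → U → ℝ) (T : ℕ) (α : ℝ) (π : Kernel X U) [IsMarkovKernel π] (s : ℝ)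
    (x : X) (u : U) : ℝ :=
  surrogateActionValue p₀ P ℓ T α π s x u - ∫ v, surrogateActionValue p₀ P ℓ T α π s x v ∂(π x)

/-- The importance ratio `ω(x, u) = π'(du | x) / π(du | x)`, jointly measurable in `(x, u)`. -/
noncomputable def importanceRatio {X U : Type*} [MeasurableSpace X] [MeasurableSpace U]
    [MeasurableSpace.CountableOrCountablyGenerated X U] (π' π : Kernel X U) (x : X) (u : U) : ℝ :=
  (Kernel.rnDeriv π' π x u).toReal

end CVaRTrustRegion

namespace CVaRTrustRegion

/-! No first-order expansion in the policy is made: `J(π') - J(π)` and the advantage integral are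
each controlled at order `√β`, so the advantage need only be prevented from being too negative.

For the risk, evaluate the Rockafellar–Uryasev objective of `π'` at the minimizer `s` of `π`; this
bounds `J(π')` from above and leaves only a change of trajectory law. Pinsker's inequality makes
each action law `O(√β)`-close, and replacing the policy one step at a time costs `T` such errors
(`abs_integral_trajLaw_sub_le`). For the advantage, centering under `π` replaces the weight `ω` by
`ω - 1`, whose `L¹` norm is again `O(√β)`.

Both estimates need a bounded excess `(L_T - s)₊`. It holds because minimizers satisfy `s ≥ -R` when
`|L_T| ≤ R` almost surely. All constants are dimension-free. -/

theorem abs_integral_le_of_ae_abs_le {Ω : Type*} [MeasurableSpace Ω] {μ : Measure Ω}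
    [IsProbabilityMeasure μ] {f : Ω → ℝ} {C : ℝ} (h : ∀ᵐ ω ∂μ, |f ω| ≤ C) :
    |∫ ω, f ω ∂μ| ≤ C := by
  simpa using norm_integral_le_of_norm_le_const (f := f) h

/-! ### Pinsker's inequality through the Hellinger bound -/

section KullbackLeibler

/-- Follows from `log y ≥ 1 - 1/y` at `y = √r`; a pointwise form of "squared Hellinger distance is
at most KL". -/
theorem sq_sqrt_sub_one_le_klFun {r : ℝ} (hr : 0 ≤ r) :
    (√r - 1) ^ 2 ≤ InformationTheory.klFun r := by
  rw [InformationTheory.klFun_apply]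
  rcases hr.eq_or_lt with rfl | hr
  · simp
  have hs : 0 < √r := Real.sqrt_pos.2 hr
  have hsq : √r * √r = r := Real.mul_self_sqrt hr.le
  have h1 : 1 - (√r)⁻¹ ≤ Real.log √r := Real.one_sub_inv_le_log_of_pos hs
  have h2 : Real.log r = 2 * Real.log √r := by rw [Real.log_sqrt hr.le]; ring
  have h3 : r * (1 - (√r)⁻¹) = r - √r := by
    have : r * (√r)⁻¹ = √r := by
      rw [← div_eq_mul_inv, div_eq_iff hs.ne', hsq]
    rw [mul_sub, this, mul_one]
  have h4 : r * (1 - (√r)⁻¹) ≤ r * Real.log √r := mul_le_mul_of_nonneg_left h1 hr.le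
  rw [h2]
  nlinarith

variable {Ω : Type*} [MeasurableSpace Ω] {μ ν : Measure Ω}

theorem absolutelyContinuous_of_klDiv_le {β : ℝ}
    (h : InformationTheory.klDiv μ ν ≤ ENNReal.ofReal β) : μ ≪ ν :=
  (InformationTheory.klDiv_ne_top_iff.1 (ne_top_of_le_ne_top ENNReal.ofReal_ne_top h)).1

/-- Factor `|r - 1| = |√r - 1| (√r + 1)`, apply weighted AM-GM, and use `(√r + 1)² ≤ 2 (r + 1)`. The
free `δ`, tuned after integration, replaces Cauchy–Schwarz. -/
theorem abs_sub_one_le_klFun {r δ : ℝ} (hr : 0 ≤ r) (hδ : 0 < δ) :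
    |r - 1| ≤ (2 * δ)⁻¹ * InformationTheory.klFun r + δ * (r + 1) := by
  have hk := sq_sqrt_sub_one_le_klFun hr
  have hsq : √r * √r = r := Real.mul_self_sqrt hr
  have hs : 0 ≤ √r := Real.sqrt_nonneg r
  have hfac : |r - 1| = |√r - 1| * (√r + 1) := by
    rw [← abs_of_nonneg (by positivity : 0 ≤ √r + 1), ← abs_mul]
    congr 1
    nlinarith
  have habs : |√r - 1| ^ 2 = (√r - 1) ^ 2 := sq_abs _
  have hmul : (2 * δ) * |r - 1| ≤ InformationTheory.klFun r + (2 * δ) * (δ * (r + 1)) := by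
    rw [hfac]
    nlinarith [sq_nonneg (|√r - 1| - δ * (√r + 1)), mul_nonneg (sq_nonneg δ) (sq_nonneg (√r - 1))]
  calc |r - 1| = (2 * δ)⁻¹ * ((2 * δ) * |r - 1|) := by field_simp
    _ ≤ (2 * δ)⁻¹ * (InformationTheory.klFun r + (2 * δ) * (δ * (r + 1))) := by gcongr
    _ = _ := by field_simp

/-- Pinsker's inequality, up to the value of the constant. -/
theorem integral_abs_rnDeriv_sub_one_le [IsProbabilityMeasure μ] [IsProbabilityMeasure ν] {β : ℝ}
    (hβ : 0 ≤ β) (h : InformationTheory.klDiv μ ν ≤ ENNReal.ofReal β) :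
    ∫ x, |(μ.rnDeriv ν x).toReal - 1| ∂ν ≤ 2 * √β := by
  obtain ⟨hac, hint⟩ :=
    InformationTheory.klDiv_ne_top_iff.1 (ne_top_of_le_ne_top ENNReal.ofReal_ne_top h)
  have hkl : ∫ x, InformationTheory.klFun (μ.rnDeriv ν x).toReal ∂ν ≤ β := by
    rw [← InformationTheory.toReal_klDiv_eq_integral_klFun hac]
    exact ENNReal.toReal_le_of_le_ofReal hβ h
  have hkint : Integrable (fun x => InformationTheory.klFun (μ.rnDeriv ν x).toReal) ν :=
    (InformationTheory.integrable_klFun_rnDeriv_iff hac).2 hint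
  have hrint : Integrable (fun x => (μ.rnDeriv ν x).toReal) ν := Measure.integrable_toReal_rnDeriv
  have hr1 : ∫ x, (μ.rnDeriv ν x).toReal ∂ν = 1 := by
    rw [Measure.integral_toReal_rnDeriv hac]; simp
  have key : ∀ δ : ℝ, 0 < δ →
      ∫ x, |(μ.rnDeriv ν x).toReal - 1| ∂ν ≤ (2 * δ)⁻¹ * β + 2 * δ := by
    intro δ hδ
    have hsum : Integrable (fun x => (μ.rnDeriv ν x).toReal + 1) ν :=
      hrint.add (integrable_const 1)
    calc ∫ x, |(μ.rnDeriv ν x).toReal - 1| ∂ν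
        ≤ ∫ x, ((2 * δ)⁻¹ * InformationTheory.klFun (μ.rnDeriv ν x).toReal
            + δ * ((μ.rnDeriv ν x).toReal + 1)) ∂ν :=
          integral_mono (hrint.sub (integrable_const 1)).abs
            ((hkint.const_mul _).add (hsum.const_mul _))
            fun x => abs_sub_one_le_klFun ENNReal.toReal_nonneg hδ
      _ = (2 * δ)⁻¹ * ∫ x, InformationTheory.klFun (μ.rnDeriv ν x).toReal ∂ν + δ * 2 := by
          rw [integral_add (hkint.const_mul _) (hsum.const_mul _), integral_const_mul,
            integral_const_mul, integral_add hrint (integrable_const 1), hr1]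
          simp
          norm_num
      _ ≤ (2 * δ)⁻¹ * β + 2 * δ := by
          rw [mul_comm δ 2]
          gcongr
  -- The optimal choice is `δ = √β / 2`; for `β = 0` it is not positive, so `δ` tends to zero
  -- instead.
  rcases hβ.eq_or_lt with rfl | hβ
  · refine le_of_forall_pos_le_add fun ε hε => ?_
    have := key (ε / 2) (by positivity)
    simpa [mul_div_cancel₀] using this
  · have hs : 0 < √β := Real.sqrt_pos.2 hβ
    have hsq : √β * √β = β := Real.mul_self_sqrt hβ.le
    have := key (√β / 2) (by positivity)
    have h2 : (2 * (√β / 2))⁻¹ * β = √β := by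
      rw [mul_div_cancel₀ _ (two_ne_zero), inv_mul_eq_iff_eq_mul₀ hs.ne', hsq]
    rw [h2] at this
    linarith

theorem abs_integral_sub_integral_le [IsProbabilityMeasure μ] [IsProbabilityMeasure ν] {β M : ℝ}
    (hβ : 0 ≤ β) (h : InformationTheory.klDiv μ ν ≤ ENNReal.ofReal β) {f : Ω → ℝ}
    (hf : Measurable f) (hM : ∀ x, |f x| ≤ M) :
    |∫ x, f x ∂μ - ∫ x, f x ∂ν| ≤ M * (2 * √β) := by
  have hac := absolutelyContinuous_of_klDiv_le h
  have hrint : Integrable (fun x => (μ.rnDeriv ν x).toReal) ν := Measure.integrable_toReal_rnDeriv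
  have hfν : Integrable f ν := .of_bound hf.aestronglyMeasurable M (ae_of_all _ hM)
  have hrf : Integrable (fun x => (μ.rnDeriv ν x).toReal * f x) ν :=
    hrint.mul_bdd (c := M) hf.aestronglyMeasurable (ae_of_all _ hM)
  have hμ : ∫ x, f x ∂μ = ∫ x, (μ.rnDeriv ν x).toReal * f x ∂ν :=
    (integral_rnDeriv_smul hac).symm
  rw [hμ, ← integral_sub hrf hfν]
  have hM0 : 0 ≤ M := by
    obtain ⟨x⟩ : Nonempty Ω := nonempty_of_isProbabilityMeasure ν
    exact (abs_nonneg _).trans (hM x)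
  calc |∫ x, ((μ.rnDeriv ν x).toReal * f x - f x) ∂ν|
      ≤ ∫ x, |(μ.rnDeriv ν x).toReal * f x - f x| ∂ν := abs_integral_le_integral_abs
    _ ≤ ∫ x, M * |(μ.rnDeriv ν x).toReal - 1| ∂ν := by
        refine integral_mono (hrf.sub hfν).abs
          ((hrint.sub (integrable_const 1)).abs.const_mul M) fun x => ?_
        have : (μ.rnDeriv ν x).toReal * f x - f x = f x * ((μ.rnDeriv ν x).toReal - 1) := by ring
        simp only [this, abs_mul]
        exact mul_le_mul_of_nonneg_right (hM x) (abs_nonneg _)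
    _ ≤ M * (2 * √β) := by
        rw [integral_const_mul]
        exact mul_le_mul_of_nonneg_left (integral_abs_rnDeriv_sub_one_le hβ h) hM0

end KullbackLeibler

/-! ### Minimizers of the Rockafellar–Uryasev objective -/

section RockafellarUryasev

variable {Ω : Type*} [MeasurableSpace Ω] {μ : Measure Ω} {Z : Ω → ℝ} {α R : ℝ}

theorem le_ruObjective (hα₀ : 0 < α) (s : ℝ) : s ≤ ruObjective α μ Z s := by
  have : 0 ≤ α⁻¹ * ∫ ω, max (Z ω - s) 0 ∂μ :=
    mul_nonneg (by positivity) (integral_nonneg fun ω => le_max_right _ _)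
  unfold ruObjective
  linarith

theorem ruObjective_eq_of_ae_le {s : ℝ} (h : ∀ᵐ ω ∂μ, Z ω ≤ s) : ruObjective α μ Z s = s := by
  have : ∫ ω, max (Z ω - s) 0 ∂μ = 0 := by
    rw [integral_eq_zero_of_ae]
    filter_upwards [h] with ω hω
    simp [hω]
  simp [ruObjective, this]

theorem cvar_eq_of_isMinOn {s : ℝ} (hs : IsMinOn (ruObjective α μ Z) Set.univ s) :
    cvar α μ Z = ruObjective α μ Z s :=
  le_antisymm (ciInf_le ⟨_, Set.forall_mem_range.2 fun t => hs (Set.mem_univ t)⟩ s)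
    (le_ciInf fun t => hs (Set.mem_univ t))

variable [IsProbabilityMeasure μ]

theorem integrable_excess (hZ : Measurable Z) (hR : ∀ᵐ ω ∂μ, |Z ω| ≤ R) (s : ℝ) :
    Integrable (fun ω => max (Z ω - s) 0) μ :=
  (((Integrable.of_bound hZ.aestronglyMeasurable R hR).sub (integrable_const s)).sup
    (integrable_const 0))

/-- Left of `-R` the positive part is inactive, so the objective is affine with slope `1 - α⁻¹`,
negative for `0 < α < 1`. -/
theorem ruObjective_sub_of_le (hZ : Measurable Z) (hR : ∀ᵐ ω ∂μ, |Z ω| ≤ R) {s : ℝ} (hs : s ≤ -R) :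
    ruObjective α μ Z s - ruObjective α μ Z (-R) = (α⁻¹ - 1) * (-R - s) := by
  have : ∫ ω, max (Z ω - s) 0 ∂μ = ∫ ω, max (Z ω - -R) 0 ∂μ + (-R - s) := by
    have h1 : ∫ ω, max (Z ω - s) 0 ∂μ = ∫ ω, (max (Z ω - -R) 0 + (-R - s)) ∂μ := by
      refine integral_congr_ae ?_
      filter_upwards [hR] with ω hω
      have := abs_le.1 hω
      rw [max_eq_left (by linarith), max_eq_left (by linarith)]
      ring
    rw [h1, integral_add (integrable_excess hZ hR _) (integrable_const _)]
    simp
  unfold ruObjective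
  rw [this]
  ring

theorem neg_le_of_isMinOn_ruObjective (hα₀ : 0 < α) (hα₁ : α < 1) (hZ : Measurable Z)
    (hR : ∀ᵐ ω ∂μ, |Z ω| ≤ R) {s : ℝ} (hs : IsMinOn (ruObjective α μ Z) Set.univ s) : -R ≤ s := by
  by_contra! hlt
  have h1 := ruObjective_sub_of_le (α := α) hZ hR hlt.le
  have h2 : ruObjective α μ Z s ≤ ruObjective α μ Z (-R) := hs (Set.mem_univ _)
  have h3 : 0 < (α⁻¹ - 1) * (-R - s) :=
    mul_pos (sub_pos.2 ((one_lt_inv₀ hα₀).2 hα₁)) (by linarith)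
  linarith

theorem continuous_ruObjective (hZ : Measurable Z) (hR : ∀ᵐ ω ∂μ, |Z ω| ≤ R) :
    Continuous (ruObjective α μ Z) := by
  have h : LipschitzWith 1 fun s => ∫ ω, max (Z ω - s) 0 ∂μ := by
    refine LipschitzWith.of_dist_le_mul fun s t => ?_
    rw [Real.dist_eq, Real.dist_eq,
      ← integral_sub (integrable_excess hZ hR _) (integrable_excess hZ hR _)]
    rw [NNReal.coe_one, one_mul]
    refine abs_integral_le_of_ae_abs_le (ae_of_all _ fun ω => ?_)
    have := abs_max_sub_max_le_abs (Z ω - s) (Z ω - t) 0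
    rwa [sub_sub_sub_cancel_left, abs_sub_comm t s] at this
  exact continuous_id.add (continuous_const.mul h.continuous)

theorem exists_isMinOn_ruObjective (hα₀ : 0 < α) (hα₁ : α < 1) (hZ : Measurable Z)
    (hR : ∀ᵐ ω ∂μ, |Z ω| ≤ R) : ∃ s, IsMinOn (ruObjective α μ Z) Set.univ s := by
  have hR0 : 0 ≤ R := by
    obtain ⟨ω, hω⟩ := hR.exists
    exact (abs_nonneg _).trans hω
  obtain ⟨s, -, hs⟩ := (isCompact_Icc (a := -R) (b := R)).exists_isMinOn
    ⟨R, by linarith, le_rfl⟩ (continuous_ruObjective (α := α) hZ hR).continuousOn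
  refine ⟨s, fun t _ => ?_⟩
  rcases lt_or_ge t (-R) with ht | ht
  · have h1 := ruObjective_sub_of_le (α := α) hZ hR ht.le
    have h2 : 0 ≤ (α⁻¹ - 1) * (-R - t) :=
      mul_nonneg (sub_nonneg.2 ((one_lt_inv₀ hα₀).2 hα₁).le) (by linarith)
    have h3 : ruObjective α μ Z s ≤ ruObjective α μ Z (-R) := hs ⟨le_rfl, by linarith⟩
    change ruObjective α μ Z s ≤ ruObjective α μ Z t
    linarith
  rcases le_or_gt t R with ht' | ht'
  · exact hs ⟨ht, ht'⟩
  -- Right of `R` the objective at `t` is at least `t`, while at `R` it equals `R`.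
  · have h1 : ruObjective α μ Z s ≤ ruObjective α μ Z R := hs ⟨by linarith, le_rfl⟩
    rw [ruObjective_eq_of_ae_le (hR.mono fun ω hω => (abs_le.1 hω).2)] at h1
    exact h1.trans (ht'.le.trans (le_ruObjective hα₀ t))

/-- A real `⨅` lies below its values only for a family bounded below; the existence of a minimizer
supplies this. -/
theorem cvar_le_ruObjective (hα₀ : 0 < α) (hα₁ : α < 1) (hZ : Measurable Z)
    (hR : ∀ᵐ ω ∂μ, |Z ω| ≤ R) (s : ℝ) : cvar α μ Z ≤ ruObjective α μ Z s := by
  obtain ⟨t, ht⟩ := exists_isMinOn_ruObjective hα₀ hα₁ hZ hR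
  exact (cvar_eq_of_isMinOn ht).trans_le (ht (Set.mem_univ s))

end RockafellarUryasev

/-! ### Trajectory laws: domination, stability in the policy, occupancy -/

section Trajectories

theorem measurable_eval_time {X U : Type*} [MeasurableSpace X] [MeasurableSpace U] (T : ℕ) :
    Measurable fun q : Fin T × ((Fin T → X × U) × X) => q.2.1 q.1 :=
  measurable_from_prod_countable_right fun t =>
    (measurable_pi_apply t).comp (measurable_fst : Measurable (Prod.fst : _ × X → Fin T → X × U))

variable {X U : Type*} [MeasurableSpace X] [MeasurableSpace U]
  {p₀ : Measure X} {P : Kernel (X × U) X} [IsMarkovKernel P] {π π' : Kernel X U}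

/-- The last transition integrates out of any function that does not read the new state. -/
theorem map_trajLaw_succ {Y : Type*} [MeasurableSpace Y] (n : ℕ)
    {f : (Fin (n + 1) → X × U) × X → Y} (hf : Measurable f)
    {g : ((Fin n → X × U) × X) × U → Y} (hg : Measurable g)
    (hfg : ∀ w y, f (Fin.snoc (α := fun _ => X × U) w.1.1 (w.1.2, w.2), y) = g w) :
    (trajLaw p₀ P π (n + 1)).map f =
      (trajLaw p₀ P π n ⊗ₘ π.comap Prod.snd measurable_snd).map g := by
  rw [trajLaw, Measure.map_map hf (measurable_snocStep n)]
  have : (f ∘ fun z : (((Fin n → X × U) × X) × U) × X =>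
      ((Fin.snoc (α := fun _ => X × U) z.1.1.1 (z.1.1.2, z.1.2) : Fin (n + 1) → X × U), z.2))
      = g ∘ Prod.fst := funext fun z => hfg z.1 z.2
  rw [this, ← Measure.map_map hg measurable_fst]
  congr 1
  exact Measure.fst_compProd _ _

variable [IsProbabilityMeasure p₀] [IsMarkovKernel π]

/-- Transfers the almost sure loss bound from `π` to `π'`, whose trajectories are not assumed to
stay in `K`. -/
theorem trajLaw_absolutelyContinuous (h : ∀ x, π' x ≪ π x) (n : ℕ) :
    trajLaw p₀ P π' n ≪ trajLaw p₀ P π n := by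
  induction n with
  | zero => exact Measure.AbsolutelyContinuous.rfl
  | succ n ih =>
    refine Measure.AbsolutelyContinuous.map ?_ (measurable_snocStep n)
    refine Measure.AbsolutelyContinuous.compProd_left ?_ _
    exact ih.compProd (ae_of_all _ fun z => h z.2)

variable [IsMarkovKernel π']

theorem integral_trajLaw_succ (n : ℕ) {F : (Fin (n + 1) → X × U) × X → ℝ} (hF : Measurable F)
    {M : ℝ} (hM : ∀ z, |F z| ≤ M) :
    ∫ z, F z ∂(trajLaw p₀ P π (n + 1)) =
      ∫ w, ∫ u, ∫ y, F (Fin.snoc (α := fun _ => X × U) w.1 (w.2, u), y) ∂(P (w.2, u)) ∂(π w.2)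
        ∂(trajLaw p₀ P π n) := by
  have hm := hF.comp (measurable_snocStep (X := X) (U := U) n)
  have hint : ∀ (μ : Measure ((((Fin n → X × U) × X) × U) × X)) [IsProbabilityMeasure μ],
      Integrable (fun z => F (Fin.snoc (α := fun _ => X × U) z.1.1.1 (z.1.1.2, z.1.2), z.2)) μ :=
    fun μ _ => .of_bound hm.aestronglyMeasurable M (ae_of_all _ fun z => hM _)
  rw [trajLaw, integral_map (measurable_snocStep n).aemeasurable hF.aestronglyMeasurable,
    Measure.integral_compProd (hint _), Measure.integral_compProd]
  · rfl
  · exact (Measure.integrable_compProd_iff hm.aestronglyMeasurable).1 (hint _) |>.2.mono'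
      (hm.stronglyMeasurable.integral_kernel_prod_right'
        (κ := P.comap (fun z : ((Fin n → X × U) × X) × U => (z.1.2, z.2))
          ((measurable_snd.comp measurable_fst).prodMk measurable_snd))).aestronglyMeasurable
      (ae_of_all _ fun w => norm_integral_le_integral_norm _)

/-- Policies that are uniformly close in total variation have close trajectory laws. -/
theorem abs_integral_trajLaw_sub_le {M ε : ℝ}
    (hπ : ∀ x, ∀ f : U → ℝ, Measurable f → (∀ u, |f u| ≤ M) →
      |∫ u, f u ∂(π' x) - ∫ u, f u ∂(π x)| ≤ ε)
    (n : ℕ) {F : (Fin n → X × U) × X → ℝ} (hF : Measurable F) (hM : ∀ z, |F z| ≤ M) :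
    |∫ z, F z ∂(trajLaw p₀ P π' n) - ∫ z, F z ∂(trajLaw p₀ P π n)| ≤ n * ε := by
  induction n with
  | zero => simp [trajLaw]
  | succ n ih =>
    rw [integral_trajLaw_succ n hF hM, integral_trajLaw_succ n hF hM]
    set H : ((Fin n → X × U) × X) × U → ℝ := fun w =>
      ∫ y, F (Fin.snoc (α := fun _ => X × U) w.1.1 (w.1.2, w.2), y) ∂(P (w.1.2, w.2)) with hH
    have hHm : Measurable H := by
      have hm := hF.comp (measurable_snocStep (X := X) (U := U) n)
      have := (hm.stronglyMeasurable.integral_kernel_prod_right'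
        (κ := P.comap (fun z : ((Fin n → X × U) × X) × U => (z.1.2, z.2))
          ((measurable_snd.comp measurable_fst).prodMk measurable_snd))).measurable
      exact this
    have hHM : ∀ w, |H w| ≤ M := fun w =>
      abs_integral_le_of_ae_abs_le (ae_of_all _ fun y => hM _)
    have hGm : ∀ ρ : Kernel X U, [IsMarkovKernel ρ] →
        Measurable fun w : (Fin n → X × U) × X => ∫ u, H (w, u) ∂(ρ w.2) := fun ρ _ =>
      (hHm.stronglyMeasurable.integral_kernel_prod_right'
        (κ := ρ.comap Prod.snd measurable_snd)).measurable
    have hGM : ∀ ρ : Kernel X U, [IsMarkovKernel ρ] →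
        ∀ w : (Fin n → X × U) × X, |∫ u, H (w, u) ∂(ρ w.2)| ≤ M := fun ρ _ w =>
      abs_integral_le_of_ae_abs_le (ae_of_all _ fun u => hHM (w, u))
    have hGi : ∀ ρ : Kernel X U, [IsMarkovKernel ρ] →
        Integrable (fun w => ∫ u, H (w, u) ∂(ρ w.2)) (trajLaw p₀ P π' n) := fun ρ _ =>
      .of_bound (hGm ρ).aestronglyMeasurable M (ae_of_all _ (hGM ρ))
    -- Hybrid argument: swapping only the last action, with the past still drawn under `π'`, costs
    -- `ε`. The past is then swapped by induction, since averaging over the last action preserves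
    -- the bound `M`.
    have h1 : |∫ w, ∫ u, H (w, u) ∂(π' w.2) ∂(trajLaw p₀ P π' n)
        - ∫ w, ∫ u, H (w, u) ∂(π w.2) ∂(trajLaw p₀ P π' n)| ≤ ε := by
      rw [← integral_sub (hGi π') (hGi π)]
      exact abs_integral_le_of_ae_abs_le
        (ae_of_all _ fun w => hπ w.2 (fun u => H (w, u)) (hHm.comp (by fun_prop))
          fun u => hHM (w, u))
    have h2 := ih (hGm π) (hGM π)
    have h3 := abs_sub_le (∫ w, ∫ u, H (w, u) ∂(π' w.2) ∂(trajLaw p₀ P π' n))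
      (∫ w, ∫ u, H (w, u) ∂(π w.2) ∂(trajLaw p₀ P π' n))
      (∫ w, ∫ u, H (w, u) ∂(π w.2) ∂(trajLaw p₀ P π n))
    push_cast
    linarith

theorem exists_map_trajLaw_eq_compProd (n : ℕ) (t : Fin n) :
    ∃ ν : Measure X, IsProbabilityMeasure ν ∧
      (trajLaw p₀ P π n).map (fun τ => τ.1 t) = ν ⊗ₘ π := by
  induction n with
  | zero => exact t.elim0
  | succ n ih =>
    refine Fin.lastCases ?_ (fun j => ?_) t
    · refine ⟨(trajLaw p₀ P π n).map Prod.snd,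
        Measure.isProbabilityMeasure_map measurable_snd.aemeasurable, ?_⟩
      rw [map_trajLaw_succ n (by fun_prop) (g := fun w => (w.1.2, w.2)) (by fun_prop)
        fun w y => by simp]
      have : IsProbabilityMeasure ((trajLaw p₀ P π n).map Prod.snd) :=
        Measure.isProbabilityMeasure_map measurable_snd.aemeasurable
      ext s hs
      rw [Measure.map_apply (by fun_prop) hs, Measure.compProd_apply hs,
        Measure.compProd_apply (hs.preimage (by fun_prop)),
        lintegral_map (Kernel.measurable_kernel_prodMk_left hs) measurable_snd]
      rfl
    · obtain ⟨ν, hν, h⟩ := ih j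
      refine ⟨ν, hν, ?_⟩
      rw [map_trajLaw_succ n (by fun_prop) (g := fun w => w.1.1 j) (by fun_prop)
        fun w y => by simp, ← h]
      rw [show (fun w : ((Fin n → X × U) × X) × U => w.1.1 j)
          = (fun τ : (Fin n → X × U) × X => τ.1 j) ∘ Prod.fst from rfl,
        ← Measure.map_map (by fun_prop) measurable_fst]
      congr 1
      exact Measure.fst_compProd _ _

/-- Given the state at time `t`, the action is drawn from the policy. -/
theorem map_eval_trajLaw (n : ℕ) (t : Fin n) :
    (trajLaw p₀ P π n).map (fun τ => τ.1 t) =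
      (trajLaw p₀ P π n).map (fun τ => (τ.1 t).1) ⊗ₘ π := by
  obtain ⟨ν, hν, h⟩ := exists_map_trajLaw_eq_compProd (p₀ := p₀) (P := P) (π := π) n t
  have : (trajLaw p₀ P π n).map (fun τ => (τ.1 t).1) = ν := by
    rw [show (fun τ : (Fin n → X × U) × X => (τ.1 t).1) = Prod.fst ∘ fun τ => τ.1 t from rfl,
      ← Measure.map_map measurable_fst (by fun_prop), h]
    exact Measure.fst_compProd _ _
  rw [this, h]

theorem isProbabilityMeasure_occupancy {T : ℕ} (hT : 1 ≤ T) :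
    IsProbabilityMeasure (occupancy p₀ P T π) := by
  have h : ∀ t : Fin T, IsProbabilityMeasure
      ((trajLaw p₀ P π T).map (fun τ => (τ.1 t).1)) := fun t =>
    Measure.isProbabilityMeasure_map (by fun_prop)
  refine ⟨?_⟩
  simp only [occupancy, Measure.smul_apply, Measure.finsetSum_apply, measure_univ, smul_eq_mul]
  simp only [Finset.sum_const, Finset.card_univ, Fintype.card_fin, nsmul_eq_mul, mul_one]
  exact ENNReal.inv_mul_cancel (by simp; omega) (by simp)

/-- A property of every state-action pair of the random-time law holds almost everywhere for the
occupancy measure. -/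
theorem occupancy_compProd_absolutelyContinuous (T : ℕ) :
    occupancy p₀ P T π ⊗ₘ π ≪
      (randomTimeLaw p₀ P T π).map (fun q => q.2.1 q.1) := by
  have hmeas := measurable_eval_time (X := X) (U := U) T
  refine Measure.AbsolutelyContinuous.mk fun s hs h0 => ?_
  rw [Measure.map_apply hmeas hs, randomTimeLaw,
    Measure.prod_apply (hs.preimage hmeas)] at h0
  have h1 : ∀ t : Fin T, trajLaw p₀ P π T ((fun τ => τ.1 t) ⁻¹' s) = 0 := by
    intro t
    rw [lintegral_fintype] at h0
    have := (Finset.sum_eq_zero_iff.1 h0) t (Finset.mem_univ t)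
    rcases mul_eq_zero.1 this with h | h
    · exact h
    -- The uniform law gives every time positive mass, so this factor cannot vanish.
    · rw [uniformOn, cond_apply MeasurableSet.univ] at h
      simp at h
  rw [occupancy, Measure.compProd_smul_left]
  simp only [Measure.smul_apply, smul_eq_mul]
  have h2 : (∑ t : Fin T, (trajLaw p₀ P π T).map (fun τ => (τ.1 t).1)) ⊗ₘ π
      = ∑ t : Fin T, (trajLaw p₀ P π T).map (fun τ => τ.1 t) := by
    simp_rw [map_eval_trajLaw, ← Measure.sum_fintype, Measure.compProd_sum_left]
  rw [h2, Measure.finsetSum_apply]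
  refine mul_eq_zero_of_right _ (Finset.sum_eq_zero fun t _ => ?_)
  rw [Measure.map_apply (by fun_prop) hs]
  exact h1 t

end Trajectories

/-- Disintegrate the joint law of `(f, g)`: an almost sure property of `g` holds almost surely in
almost every fibre. -/
theorem ae_condDistrib_of_ae {Ω Y Z : Type*} [MeasurableSpace Ω] [MeasurableSpace Y]
    [MeasurableSpace Z] [StandardBorelSpace Z] [Nonempty Z] {μ : Measure Ω} [IsFiniteMeasure μ]
    {f : Ω → Y} {g : Ω → Z} (hf : Measurable f) (hg : Measurable g) {p : Z → Prop}
    (hp : MeasurableSet {z | p z}) (h : ∀ᵐ ω ∂μ, p (g ω)) :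
    ∀ᵐ y ∂(μ.map f), ∀ᵐ z ∂(condDistrib g f μ y), p z := by
  refine Measure.ae_ae_of_ae_compProd (p := fun w => p w.2) ?_
  rw [compProd_map_condDistrib hg.aemeasurable]
  exact (ae_map_iff (hf.prodMk hg).aemeasurable (hp.preimage measurable_snd)).2 h

/-! ### Importance-weighted integrals of centered functions -/

section ImportanceSampling

variable {X U : Type*} [MeasurableSpace X] [MeasurableSpace U] {ν : Measure X}
  [IsProbabilityMeasure ν] {π π' : Kernel X U} {g : X → U → ℝ} {M : ℝ}

theorem measurable_importanceRatio
    [MeasurableSpace.CountableOrCountablyGenerated X U] :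
    Measurable fun z : X × U => importanceRatio π' π z.1 z.2 :=
  (Kernel.measurable_rnDeriv π' π).ennreal_toReal

variable [IsMarkovKernel π]

theorem measurable_sub_integral (hg : Measurable (Function.uncurry g)) :
    Measurable fun z : X × U => g z.1 z.2 - ∫ v, g z.1 v ∂(π z.1) :=
  hg.sub ((hg.stronglyMeasurable.integral_kernel_prod_right' (κ := π)).measurable.comp
    measurable_fst)

theorem ae_abs_sub_integral_le (hM : ∀ᵐ z ∂(ν ⊗ₘ π), |g z.1 z.2| ≤ M) :
    ∀ᵐ x ∂ν, ∀ᵐ u ∂(π x), |g x u - ∫ v, g x v ∂(π x)| ≤ 2 * M := by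
  filter_upwards [Measure.ae_ae_of_ae_compProd hM] with x hx
  have hint : |∫ v, g x v ∂(π x)| ≤ M :=
    abs_integral_le_of_ae_abs_le hx
  filter_upwards [hx] with u hu
  have := abs_sub (g x u) (∫ v, g x v ∂(π x))
  linarith

variable [MeasurableSpace.CountableOrCountablyGenerated X U] [IsMarkovKernel π']

theorem importanceRatio_ae_eq (x : X) :
    importanceRatio π' π x =ᵐ[π x] fun u => ((π' x).rnDeriv (π x) u).toReal := by
  filter_upwards [Kernel.rnDeriv_eq_rnDeriv_measure (κ := π') (η := π) (a := x)] with u hu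
  rw [importanceRatio, hu]

theorem integrable_importanceRatio_apply (x : X) : Integrable (importanceRatio π' π x) (π x) :=
  (integrable_congr (importanceRatio_ae_eq x)).2 Measure.integrable_toReal_rnDeriv

theorem integrable_importanceRatio (hac : ∀ x, π' x ≪ π x) :
    Integrable (fun z : X × U => importanceRatio π' π z.1 z.2) (ν ⊗ₘ π) := by
  rw [Measure.integrable_compProd_iff measurable_importanceRatio.aestronglyMeasurable]
  refine ⟨ae_of_all _ fun x => integrable_importanceRatio_apply x, ?_⟩
  have : (fun x => ∫ u, ‖importanceRatio π' π x u‖ ∂(π x)) = fun _ => (1 : ℝ) := by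
    funext x
    have h1 : ∀ u, ‖importanceRatio π' π x u‖ = importanceRatio π' π x u := fun u =>
      Real.norm_of_nonneg ENNReal.toReal_nonneg
    simp_rw [h1]
    rw [integral_congr_ae (importanceRatio_ae_eq x), Measure.integral_toReal_rnDeriv (hac x)]
    simp
  rw [this]
  exact integrable_const 1

theorem integrable_importanceRatio_mul (hac : ∀ x, π' x ≪ π x)
    (hg : Measurable (Function.uncurry g)) (hM : ∀ᵐ z ∂(ν ⊗ₘ π), |g z.1 z.2| ≤ M) :
    Integrable (fun z : X × U =>
      importanceRatio π' π z.1 z.2 * (g z.1 z.2 - ∫ v, g z.1 v ∂(π z.1))) (ν ⊗ₘ π) := by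
  refine (integrable_importanceRatio hac).mul_bdd (c := 2 * M)
    (measurable_sub_integral hg).aestronglyMeasurable ?_
  refine (Measure.ae_compProd_iff ?_).2 (ae_abs_sub_integral_le hM)
  exact measurableSet_le (measurable_sub_integral hg).norm measurable_const

/-- The importance-weighted mean of a function that is centered under `π` is small if `π'` is
close to `π`. -/
theorem abs_integral_importanceRatio_mul_le {β : ℝ} (hβ : 0 ≤ β)
    (hkl : ∀ x, InformationTheory.klDiv (π' x) (π x) ≤ ENNReal.ofReal β)
    (hg : Measurable (Function.uncurry g)) (hM : ∀ᵐ z ∂(ν ⊗ₘ π), |g z.1 z.2| ≤ M) :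
    |∫ z, importanceRatio π' π z.1 z.2 * (g z.1 z.2 - ∫ v, g z.1 v ∂(π z.1)) ∂(ν ⊗ₘ π)|
      ≤ 2 * M * (2 * √β) := by
  have hac := fun x => absolutelyContinuous_of_klDiv_le (hkl x)
  rw [Measure.integral_compProd (integrable_importanceRatio_mul hac hg hM)]
  suffices h : ∀ᵐ x ∂ν, |∫ u, importanceRatio π' π x u * (g x u - ∫ v, g x v ∂(π x)) ∂(π x)|
      ≤ 2 * M * (2 * √β) from abs_integral_le_of_ae_abs_le h
  filter_upwards [ae_abs_sub_integral_le hM, Measure.ae_ae_of_ae_compProd hM] with x hx hgx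
  set A : U → ℝ := fun u => g x u - ∫ v, g x v ∂(π x) with hA
  have hgm : Measurable (g x) := hg.comp measurable_prodMk_left
  have hgi : Integrable (g x) (π x) := .of_bound hgm.aestronglyMeasurable M hgx
  have hAi : Integrable A (π x) := hgi.sub (integrable_const _)
  have hA0 : ∫ u, A u ∂(π x) = 0 := by
    rw [integral_sub hgi (integrable_const _)]
    simp
  have hωi := integrable_importanceRatio_apply (π := π) (π' := π') x
  have hωA : Integrable (fun u => importanceRatio π' π x u * A u) (π x) :=
    hωi.mul_bdd (c := 2 * M) hAi.aestronglyMeasurable hx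
  have hM0 : 0 ≤ 2 * M := by
    obtain ⟨u, hu⟩ := hx.exists
    exact (abs_nonneg _).trans hu
  calc |∫ u, importanceRatio π' π x u * A u ∂(π x)|
      -- Subtracting `A` is free because it has mean zero under `π x`; the weight becomes `ω - 1`.
      = |∫ u, (importanceRatio π' π x u * A u - A u) ∂(π x)| := by
        rw [integral_sub hωA hAi, hA0, sub_zero]
    _ ≤ ∫ u, |importanceRatio π' π x u * A u - A u| ∂(π x) := abs_integral_le_integral_abs
    _ ≤ ∫ u, 2 * M * |importanceRatio π' π x u - 1| ∂(π x) := by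
        refine integral_mono_ae (hωA.sub hAi).abs
          ((hωi.sub (integrable_const 1)).abs.const_mul _) ?_
        filter_upwards [hx] with u hu
        have : importanceRatio π' π x u * A u - A u = A u * (importanceRatio π' π x u - 1) := by
          ring
        rw [this, abs_mul]
        exact mul_le_mul_of_nonneg_right hu (abs_nonneg _)
    _ = 2 * M * ∫ u, |((π' x).rnDeriv (π x) u).toReal - 1| ∂(π x) := by
        rw [integral_const_mul]
        congr 1
        refine integral_congr_ae ?_
        filter_upwards [importanceRatio_ae_eq (π := π) (π' := π') x] with u hu
        rw [hu]
    _ ≤ 2 * M * (2 * √β) :=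
        mul_le_mul_of_nonneg_left (integral_abs_rnDeriv_sub_one_le hβ (hkl x)) hM0

end ImportanceSampling

theorem abs_excess_le {y s R : ℝ} (hy : |y| ≤ R) (hs : -R ≤ s) : |max (y - s) 0| ≤ 2 * R := by
  have := abs_le.1 hy
  rw [abs_of_nonneg (le_max_right _ _)]
  exact max_le (by linarith) (by linarith)

/-! ### Bounds for the surrogate and for the risk of the new policy -/

section Surrogate

variable {X U : Type*} [MeasurableSpace X] [MeasurableSpace U]
  {p₀ : Measure X} [IsProbabilityMeasure p₀] {P : Kernel (X × U) X} [IsMarkovKernel P]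
  {π : Kernel X U} [IsMarkovKernel π] {ℓ : X → U → ℝ} {T : ℕ} {α R s : ℝ}

theorem measurable_totalLoss (hℓ : Measurable (Function.uncurry ℓ)) :
    Measurable (totalLoss ℓ : (Fin T → X × U) × X → ℝ) :=
  Finset.measurable_fun_sum _ fun t _ =>
    hℓ.comp (by fun_prop : Measurable fun τ : (Fin T → X × U) × X => τ.1 t)

theorem measurable_surrogateActionValue :
    Measurable (Function.uncurry (surrogateActionValue p₀ P ℓ T α π s)) := by
  have h : StronglyMeasurable fun w : (X × U) × ℝ => max (w.2 - s) 0 :=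
    ((measurable_snd.sub_const s).max measurable_const).stronglyMeasurable
  exact (h.integral_kernel_prod_right').measurable.const_mul _

theorem ae_abs_surrogateActionValue_le (hα₀ : 0 < α) (hℓ : Measurable (Function.uncurry ℓ))
    (hR : ∀ᵐ τ ∂(trajLaw p₀ P π T), |totalLoss ℓ τ| ≤ R) (hs : -R ≤ s) :
    ∀ᵐ z ∂(occupancy p₀ P T π ⊗ₘ π),
      |surrogateActionValue p₀ P ℓ T α π s z.1 z.2| ≤ T / α * (2 * R) := by
  have hloss : Measurable fun q : Fin T × ((Fin T → X × U) × X) => totalLoss ℓ q.2 :=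
    (measurable_totalLoss hℓ).comp measurable_snd
  have hq : ∀ᵐ q ∂(randomTimeLaw p₀ P T π), |totalLoss ℓ q.2| ≤ R :=
    Measure.quasiMeasurePreserving_snd.ae hR
  have h := ae_condDistrib_of_ae (measurable_eval_time T) hloss (p := fun y => |y| ≤ R)
    (measurableSet_le measurable_abs measurable_const) hq
  filter_upwards [occupancy_compProd_absolutelyContinuous T h] with z hz
  have hb : |∫ y, max (y - s) 0 ∂(condDistrib
      (fun q : Fin T × ((Fin T → X × U) × X) => totalLoss ℓ q.2)
      (fun q => q.2.1 q.1) (randomTimeLaw p₀ P T π) (z.1, z.2))| ≤ 2 * R :=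
    abs_integral_le_of_ae_abs_le (hz.mono fun y hy => abs_excess_le hy hs)
  rw [surrogateActionValue, abs_mul, abs_of_nonneg (by positivity)]
  gcongr

/-- The CVaR of a policy `π'` exceeds the Rockafellar–Uryasev objective of a close policy `π` by at
most a multiple of `√β`. -/
theorem riskObjective_le_ruObjective_add {π' : Kernel X U} [IsMarkovKernel π'] {β : ℝ}
    (hα₀ : 0 < α) (hα₁ : α < 1) (hβ : 0 ≤ β)
    (hkl : ∀ x, InformationTheory.klDiv (π' x) (π x) ≤ ENNReal.ofReal β)
    (hℓ : Measurable (Function.uncurry ℓ))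
    (hR : ∀ᵐ τ ∂(trajLaw p₀ P π T), |totalLoss ℓ τ| ≤ R) (hs : -R ≤ s) :
    riskObjective p₀ P ℓ T α π' ≤ ruObjective α (trajLaw p₀ P π T) (totalLoss ℓ) s
      + α⁻¹ * (T * (2 * R * (2 * √β))) := by
  have hm := measurable_totalLoss (T := T) hℓ
  have hR' : ∀ᵐ τ ∂(trajLaw p₀ P π' T), |totalLoss ℓ τ| ≤ R :=
    trajLaw_absolutelyContinuous (fun x => absolutelyContinuous_of_klDiv_le (hkl x)) T hR
  have hR0 : 0 ≤ 2 * R := by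
    obtain ⟨τ, hτ⟩ := hR.exists
    linarith [(abs_nonneg _).trans hτ]
  -- The law comparison requires a bound everywhere, but the excess is at most `2R` only almost
  -- surely. Truncation changes neither integral.
  set F : (Fin T → X × U) × X → ℝ := fun τ => min (max (totalLoss ℓ τ - s) 0) (2 * R) with hF
  have hFm : Measurable F := ((hm.sub_const s).max measurable_const).min measurable_const
  have hFb : ∀ τ, |F τ| ≤ 2 * R := fun τ => by
    rw [abs_of_nonneg (le_min (le_max_right _ _) hR0)]
    exact min_le_right _ _
  have hFeq : ∀ μ : Measure ((Fin T → X × U) × X), (∀ᵐ τ ∂μ, |totalLoss ℓ τ| ≤ R) →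
      ∫ τ, max (totalLoss ℓ τ - s) 0 ∂μ = ∫ τ, F τ ∂μ := fun μ hμ => by
    refine integral_congr_ae ?_
    filter_upwards [hμ] with τ hτ
    exact (min_eq_left ((le_abs_self _).trans (abs_excess_le hτ hs))).symm
  have hdiff := abs_integral_trajLaw_sub_le (p₀ := p₀) (P := P) (M := 2 * R)
    (fun x f hf hb => abs_integral_sub_integral_le hβ (hkl x) hf hb) T hFm hFb
  have hle := cvar_le_ruObjective hα₀ hα₁ hm hR' s
  refine hle.trans ?_
  unfold ruObjective
  rw [hFeq _ hR, hFeq _ hR', add_assoc, ← mul_add]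
  gcongr
  linarith [(abs_le.1 hdiff).2]

end Surrogate

end CVaRTrustRegion

/-! ### The improvement inequality -/

theorem theorem4 (α : ℝ) (hα₀ : 0 < α) (hα₁ : α < 1) (T : ℕ) (hT : 1 ≤ T) (L B : ℝ) :
    ∃ C : ℝ, 0 < C ∧
      ∀ (d m : ℕ)
        (p₀ : Measure (EuclideanSpace ℝ (Fin d))) [IsProbabilityMeasure p₀]
        (P : Kernel (EuclideanSpace ℝ (Fin d) × EuclideanSpace ℝ (Fin m))
          (EuclideanSpace ℝ (Fin d))) [IsMarkovKernel P]
        (ℓ : EuclideanSpace ℝ (Fin d) → EuclideanSpace ℝ (Fin m) → ℝ)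
        (K : Set (EuclideanSpace ℝ (Fin d) × EuclideanSpace ℝ (Fin m)))
        (π π' : Kernel (EuclideanSpace ℝ (Fin d)) (EuclideanSpace ℝ (Fin m)))
        [IsMarkovKernel π] [IsMarkovKernel π'] (β : ℝ),
        Measurable (Function.uncurry ℓ) →
        -- the trajectories under `π` stay in `K`, where the one-step loss is bounded and Lipschitz
        (∀ᵐ τ ∂(CVaRTrustRegion.trajLaw p₀ P π T), ∀ t : Fin T, τ.1 t ∈ K) →
        (∀ z ∈ K, |ℓ z.1 z.2| ≤ B) →
        (∀ z ∈ K, ∀ z' ∈ K, |ℓ z.1 z.2 - ℓ z'.1 z'.2| ≤ L * (‖z.1 - z'.1‖ + ‖z.2 - z'.2‖)) →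
        0 ≤ β →
        (∀ x, InformationTheory.klDiv (π' x) (π x) ≤ ENNReal.ofReal β) →
        -- the minimum that defines `CVaR_α(L_T(π))` is attained
        (∃ s, IsMinOn (CVaRTrustRegion.ruObjective α (CVaRTrustRegion.trajLaw p₀ P π T)
          (CVaRTrustRegion.totalLoss ℓ)) Set.univ s) ∧
        -- and at every minimizer the improvement inequality holds
        ∀ s, IsMinOn (CVaRTrustRegion.ruObjective α (CVaRTrustRegion.trajLaw p₀ P π T)
            (CVaRTrustRegion.totalLoss ℓ)) Set.univ s →
          Integrable (fun z => CVaRTrustRegion.importanceRatio π' π z.1 z.2 *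
              CVaRTrustRegion.cvarAdvantage p₀ P ℓ T α π s z.1 z.2)
            ((CVaRTrustRegion.occupancy p₀ P T π) ⊗ₘ π) ∧
          CVaRTrustRegion.riskObjective p₀ P ℓ T α π' ≤
            CVaRTrustRegion.riskObjective p₀ P ℓ T α π +
              (∫ z, CVaRTrustRegion.importanceRatio π' π z.1 z.2 *
                  CVaRTrustRegion.cvarAdvantage p₀ P ℓ T α π s z.1 z.2
                ∂((CVaRTrustRegion.occupancy p₀ P T π) ⊗ₘ π)) +
              C * Real.sqrt β := by
  -- The constant is fixed before any data, so `B` may be negative; `|B|` keeps `R ≥ 0`.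
  set R : ℝ := T * |B| with hRdef
  have hR0 : 0 ≤ R := by positivity
  -- The summands pay for the change of trajectory law, for the advantage integral, and for strict
  -- positivity when `R = 0`.
  refine ⟨α⁻¹ * (T * (2 * R * 2)) + 2 * (T / α * (2 * R)) * 2 + 1, by positivity, ?_⟩
  intro d m p₀ _ P _ ℓ K π π' _ _ β hℓ hK hB _ hβ hkl
  have hR : ∀ᵐ τ ∂(CVaRTrustRegion.trajLaw p₀ P π T), |CVaRTrustRegion.totalLoss ℓ τ| ≤ R := by
    filter_upwards [hK] with τ hτ
    calc |CVaRTrustRegion.totalLoss ℓ τ| ≤ ∑ t : Fin T, |ℓ (τ.1 t).1 (τ.1 t).2| :=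
          Finset.abs_sum_le_sum_abs _ _
      _ ≤ ∑ _t : Fin T, |B| :=
          Finset.sum_le_sum fun t _ => (hB _ (hτ t)).trans (le_abs_self B)
      _ = R := by simp [hRdef]
  have hm := CVaRTrustRegion.measurable_totalLoss (T := T) hℓ
  refine ⟨CVaRTrustRegion.exists_isMinOn_ruObjective hα₀ hα₁ hm hR, fun s hs => ?_⟩
  have hsR := CVaRTrustRegion.neg_le_of_isMinOn_ruObjective hα₀ hα₁ hm hR hs
  have hocc : IsProbabilityMeasure (CVaRTrustRegion.occupancy p₀ P T π) :=
    CVaRTrustRegion.isProbabilityMeasure_occupancy hT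
  have hgm := CVaRTrustRegion.measurable_surrogateActionValue
    (p₀ := p₀) (P := P) (ℓ := ℓ) (T := T) (α := α) (π := π) (s := s)
  have hgb := CVaRTrustRegion.ae_abs_surrogateActionValue_le hα₀ hℓ hR hsR
  refine ⟨CVaRTrustRegion.integrable_importanceRatio_mul
    (fun x => CVaRTrustRegion.absolutelyContinuous_of_klDiv_le (hkl x)) hgm hgb, ?_⟩
  have hadv := CVaRTrustRegion.abs_integral_importanceRatio_mul_le hβ hkl hgm hgb
  have hrisk := CVaRTrustRegion.riskObjective_le_ruObjective_add hα₀ hα₁ hβ hkl hℓ hR hsR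
  have hJ : CVaRTrustRegion.riskObjective p₀ P ℓ T α π = _ :=
    CVaRTrustRegion.cvar_eq_of_isMinOn hs
  rw [hJ]
  have hlow := (abs_le.1 hadv).1
  simp only [CVaRTrustRegion.cvarAdvantage]
  have hsqrt := Real.sqrt_nonneg β
  linarith
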